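/- **Conventions.** Let $X$ be a complex $*$-vector space, $\mathbb N=\{1,2,\dots\}$, and let $M_{l,m}(X)$ be the $l\times m$ matrices over $X$, with $M_n(X)=M_{n,n}(X)$, $(x^*)_{ij}=(x_{ji})^*$, $M_n(X)_{sa}=\{x\in M_n(X): x=x^*\}$, and the obvious left and right multiplication by scalar matrices (with operator norm). Write $x\oplus y$ for the block diagonal matrix with blocks $x,y$, and $x^n=x\oplus\cdots\oplus x$ ($n$ summands). An *absolute matrix order unit space* is $X$ together with convex cones $M_n(X)^+\subseteq M_n(X)_{sa}$ (with $u\le v$ meaning $v-u\in M_n(X)^+$), maps $|\cdot|_{l,m}:M_{l,m}(X)\to M_m(X)^+$ (written $|\cdot|$) and an element $e\in X^+=M_1(X)^+$ such that: 1. $a^*va\in M_m(X)^+$ for $v\in M_n(X)^+$, $a\in M_{n,m}(\mathbb C)$; $e$ is an order unit of $X_{sa}$; $X^+\cap(-X^+)=\{0\}$; every $M_n(X)^+$ is Archimedean (if $u\in M_n(X)^+$, $v\in M_n(X)_{sa}$ and $ku+v\in M_n(X)^+$ for all real $k>0$, then $v\in M_n(X)^+$). 2. On each $M_n(X)_{sa}$,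 writing $u\perp v$ for $|u-v|=u+v$: $|v|=v$ if $v\ge0$; $\pm v\le |v|$; $|kv|=|k||v|$ for $k\in\mathbb R$; if $u\perp v$ and $0\le w\le v$ then $u\perp w$; if $u\perp v$ and $u\perp w$ then $u\perp|v\pm w|$. 3. $|axb|\le\|a\|\,\big||x|b\big|$ for scalar matrices $a,b$ of suitable sizes, and $|x\oplus y|=|x|\oplus|y|$. 4. With $\|y\|_n=\inf\{\epsilon>0:\begin{bmatrix}\epsilon e^n&y\\y^*&\epsilon e^n\end{bmatrix}\in M_{2n}(X)^+\}$, for $u,v\in M_n(X)^+$ one has $u\perp v$ if and only if $\|\alpha u_1+\beta v_1\|_n=\max\{\|\alpha u_1\|_n,\|\beta v_1\|_n\}$ for all $0\le u_1\le u$, $0\le v_1\le v$ and $\alpha,\beta\in\mathbb R$. An *order projection* is $p\in M_n(X)_{sa}$ with $|2p-e^n|=e^n$; $\mathrm{OP}_n(X)$ is the set of these and $\mathrm{OP}_\infty(X)=\bigsqcup_n \mathrm{OP}_n(X)$. A *partial isometry* is $v\in M_{m,n}(X)$ such that $|v|$ and $|v^*|$ are order projections. *Condition (T)*: if $u\in M_{m,n}(X)$,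 $v\in M_{l,n}(X)$ are partial isometries with $|u|=|v|$, there is a partial isometry $w\in M_{m,l}(X)$ with $|w^*|=|u^*|$ and $|w|=|v^*|$. For $p\in \mathrm{OP}_m(X)$, $q\in\mathrm{OP}_n(X)$ write $p\sim q$ if $p=|v^*|$, $q=|v|$ for some $v\in M_{m,n}(X)$, and $p\approx q$ if $p\oplus r\sim q\oplus r$ for some $r\in\mathrm{OP}_\infty(X)$. If (T) holds, $K_0(X)$ is the Grothendieck group of the commutative monoid $(\mathrm{OP}_\infty(X)/{\sim},\oplus)$, that is, the set of classes $[(p,q)]$ of pairs of order projections, where $[(p,q)]=[(r,s)]$ if and only if $p\oplus s\approx r\oplus q$, with $[(p,q)]+[(r,s)]=[(p\oplus r,q\oplus s)]$. An element $x\in X^+$ has the *absolute matrix order unit property* if, for every $n$, $|y|\le\|y\|_n x^n$ for every $y\in M_n(X)_{sa}$ with $\pm y\le\epsilon x^n$ for some $\epsilon>0$. For such $x$ with $\|x\|=1$, the subspace $$X_x=\Big\{y\in X:\begin{bmatrix}\epsilon x&y\\y^*&\epsilon x\end{bmatrix}\in M_2(X)^+\text{ for some }\epsilon>0\Big\},$$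 with the cones $M_n(X)^+\cap M_n(X_x)$, the absolute values of $X$ and the order unit $x$, is an absolute matrix order unit space. **Theorem.** Let $X$ be an absolute matrix order unit space in which (T) holds, and let $x\in X^+$ with $\|x\|=1$ have the absolute matrix order unit property. Then (T) holds in $X_x$, every order projection of $X_x$ is an order projection of $X$, and $[(p,q)]\mapsto[(p,q)]$ defines a group homomorphism $K_0(X_x)\to K_0(X)$. If moreover, for all $p,q\in\mathrm{OP}_\infty(X_x)$, $p\approx q$ in $X$ implies $p\approx q$ in $X_x$, then this homomorphism is injective. -/

import Mathlib

open Matrix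
open scoped Matrix.Norms.L2Operator

namespace AMOU

/-- The index set `{1, …, n}`. -/
def Idx (n : ℕ+) : Type := Fin n

instance (n : ℕ+) : Fintype (Idx n) := inferInstanceAs (Fintype (Fin n))

instance (n : ℕ+) : DecidableEq (Idx n) := inferInstanceAs (DecidableEq (Fin n))

instance : Unique (Idx 1) := inferInstanceAs (Unique (Fin 1))

instance (n : ℕ+) : Nonempty (Idx n) := ⟨(⟨0, n.pos⟩ : Fin n)⟩

/-- Matrices of positive size `m × n`. -/
abbrev Mat (m n : ℕ+) (X : Type*) := Matrix (Idx m) (Idx n) X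

/-- The index set of a block matrix. -/
def sumEquiv (m n : ℕ+) : Idx m ⊕ Idx n ≃ Idx (m + n) :=
  (finSumFinEquiv (m := m) (n := n)).trans (finCongr (PNat.add_coe m n).symm)

/-- The block matrix with rows `(a, b)` and `(c, d)`. -/
def blocks {X : Type*} {l n m s : ℕ+} (a : Mat l m X) (b : Mat l s X) (c : Mat n m X)
    (d : Mat n s X) : Mat (l + n) (m + s) X :=
  Matrix.reindex (sumEquiv l n) (sumEquiv m s) (Matrix.fromBlocks a b c d)

/-- The block diagonal matrix of two (rectangular) matrices. -/
def dsum {X : Type*} [Zero X] {l n m s : ℕ+} (x : Mat l m X) (y : Mat n s X) :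
    Mat (l + n) (m + s) X :=
  blocks x 0 0 y

/-- `x ⊕ ⋯ ⊕ x` with `n` summands, for `x : X`. For `n = 1` this identifies `X` with the
`1 × 1` matrices over `X`. -/
def amp {X : Type*} [Zero X] (n : ℕ+) (x : X) : Mat n n X := Matrix.diagonal fun _ => x

section Scalars

variable {X : Type*} [AddCommGroup X] [Module ℂ X]

/-- Left multiplication of a matrix over `X` by a scalar matrix. -/
def lmul {l m n : ℕ+} (a : Mat l m ℂ) (x : Mat m n X) : Mat l n X :=
  Matrix.of fun i j => ∑ k, a i k • x k j

/-- Right multiplication of a matrix over `X` by a scalar matrix. -/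
def rmul {l m n : ℕ+} (x : Mat l m X) (a : Mat m n ℂ) : Mat l n X :=
  Matrix.of fun i j => ∑ k, a k j • x i k

end Scalars

/-- A matrix ordered space: a complex `*`-vector space `X` with a convex cone of self-adjoint
matrices at every matrix level, compatible with `v ↦ a⋆ v a` for scalar matrices `a`. -/
structure MatrixOrderedSpace (X : Type*) [AddCommGroup X] [Module ℂ X] [StarAddMonoid X]
    [StarModule ℂ X] where
  pos : ∀ n : ℕ+, Set (Mat n n X)
  isHermitian_of_pos : ∀ {n : ℕ+} {v : Mat n n X}, v ∈ pos n → v.IsHermitian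
  zero_mem : ∀ n : ℕ+, (0 : Mat n n X) ∈ pos n
  add_mem : ∀ {n : ℕ+} {v w : Mat n n X}, v ∈ pos n → w ∈ pos n → v + w ∈ pos n
  smul_mem : ∀ {n : ℕ+} {v : Mat n n X} {k : ℝ}, 0 ≤ k → v ∈ pos n → (k : ℂ) • v ∈ pos n
  conj_mem : ∀ {n m : ℕ+} {v : Mat n n X} (a : Mat n m ℂ),
    v ∈ pos n → lmul aᴴ (rmul v a) ∈ pos m

/-- A matrix order unit space: `unit` is an order unit for the self-adjoint part of `X`, the cone
of `X` is proper and all the cones are Archimedean. -/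
structure MatrixOrderUnitSpace (X : Type*) [AddCommGroup X] [Module ℂ X] [StarAddMonoid X]
    [StarModule ℂ X] extends MatrixOrderedSpace X where
  unit : X
  unit_pos : amp 1 unit ∈ pos 1
  order_unit : ∀ y : X, IsSelfAdjoint y →
    ∃ ε : ℝ, 0 < ε ∧ amp 1 ((ε : ℂ) • unit + y) ∈ pos 1 ∧ amp 1 ((ε : ℂ) • unit - y) ∈ pos 1
  proper : ∀ y : X, amp 1 y ∈ pos 1 → amp 1 (-y) ∈ pos 1 → y = 0
  archimedean : ∀ {n : ℕ+} {u v : Mat n n X}, u ∈ pos n → v.IsHermitian →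
    (∀ k : ℝ, 0 < k → (k : ℂ) • u + v ∈ pos n) → v ∈ pos n

namespace MatrixOrderUnitSpace

variable {X : Type*} [AddCommGroup X] [Module ℂ X] [StarAddMonoid X] [StarModule ℂ X]

/-- The matrix norm determined by the order unit. -/
noncomputable def matNorm (S : MatrixOrderUnitSpace X) {n : ℕ+} (y : Mat n n X) : ℝ :=
  sInf {ε : ℝ | 0 < ε ∧
    blocks (amp n ((ε : ℂ) • S.unit)) y yᴴ (amp n ((ε : ℂ) • S.unit)) ∈ S.pos (n + n)}

/-- `u ⊥_∞ v`. -/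
def OrthInf (S : MatrixOrderUnitSpace X) {n : ℕ+} (u v : Mat n n X) : Prop :=
  ∀ α β : ℝ, S.matNorm ((α : ℂ) • u + (β : ℂ) • v) =
    max (S.matNorm ((α : ℂ) • u)) (S.matNorm ((β : ℂ) • v))

/-- `u ⊥_∞^a v`: `u₁ ⊥_∞ v₁` whenever `0 ≤ u₁ ≤ u` and `0 ≤ v₁ ≤ v`. -/
def AbsOrthInf (S : MatrixOrderUnitSpace X) {n : ℕ+} (u v : Mat n n X) : Prop :=
  ∀ u₁ v₁ : Mat n n X, u₁ ∈ S.pos n → u - u₁ ∈ S.pos n → v₁ ∈ S.pos n → v - v₁ ∈ S.pos n →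
    S.OrthInf u₁ v₁

end MatrixOrderUnitSpace

/-- An absolute matrix order unit space. The fields `abs_of_pos` to `orth_abs_sub` say that the
self-adjoint matrices of each size form an absolutely ordered space, where `u ⊥ v` means
`|u - v| = u + v`. The norm of a scalar matrix is its operator norm. -/
structure AbsMatrixOrderUnitSpace (X : Type*) [AddCommGroup X] [Module ℂ X] [StarAddMonoid X]
    [StarModule ℂ X] extends MatrixOrderUnitSpace X where
  abs : ∀ {l m : ℕ+}, Mat l m X → Mat m m X
  abs_mem : ∀ {l m : ℕ+} (x : Mat l m X), abs x ∈ pos m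
  abs_of_pos : ∀ {n : ℕ+} {v : Mat n n X}, v ∈ pos n → abs v = v
  abs_add_mem : ∀ {n : ℕ+} {v : Mat n n X}, v.IsHermitian → abs v + v ∈ pos n
  abs_sub_mem : ∀ {n : ℕ+} {v : Mat n n X}, v.IsHermitian → abs v - v ∈ pos n
  abs_smul : ∀ {n : ℕ+} {v : Mat n n X} (k : ℝ), v.IsHermitian →
    abs ((k : ℂ) • v) = ((|k| : ℝ) : ℂ) • abs v
  orth_of_le : ∀ {n : ℕ+} {u v w : Mat n n X}, u.IsHermitian → v.IsHermitian →
    w.IsHermitian → abs (u - v) = u + v → w ∈ pos n → v - w ∈ pos n → abs (u - w) = u + w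
  orth_abs_add : ∀ {n : ℕ+} {u v w : Mat n n X}, u.IsHermitian → v.IsHermitian →
    w.IsHermitian → abs (u - v) = u + v → abs (u - w) = u + w →
    abs (u - abs (v + w)) = u + abs (v + w)
  orth_abs_sub : ∀ {n : ℕ+} {u v w : Mat n n X}, u.IsHermitian → v.IsHermitian →
    w.IsHermitian → abs (u - v) = u + v → abs (u - w) = u + w →
    abs (u - abs (v - w)) = u + abs (v - w)
  abs_mul_le : ∀ {l m n s : ℕ+} (a : Mat l m ℂ) (x : Mat m n X) (b : Mat n s ℂ),
    (‖a‖ : ℂ) • abs (rmul (abs x) b) - abs (lmul a (rmul x b)) ∈ pos s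
  abs_dsum : ∀ {l m n s : ℕ+} (x : Mat m n X) (y : Mat l s X),
    abs (dsum x y) = dsum (abs x) (abs y)
  orth_iff : ∀ {n : ℕ+} {u v : Mat n n X}, u ∈ pos n → v ∈ pos n →
    (abs (u - v) = u + v ↔ toMatrixOrderUnitSpace.AbsOrthInf u v)

section Basic

@[simp] theorem blocks_inl_inl {X : Type*} {l n m s : ℕ+} (a : Mat l m X) (b : Mat l s X)
    (c : Mat n m X) (d : Mat n s X) (i : Idx l) (j : Idx m) :
    blocks a b c d (sumEquiv l n (.inl i)) (sumEquiv m s (.inl j)) = a i j := by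
  simp [blocks]

@[simp] theorem blocks_inl_inr {X : Type*} {l n m s : ℕ+} (a : Mat l m X) (b : Mat l s X)
    (c : Mat n m X) (d : Mat n s X) (i : Idx l) (j : Idx s) :
    blocks a b c d (sumEquiv l n (.inl i)) (sumEquiv m s (.inr j)) = b i j := by
  simp [blocks]

@[simp] theorem blocks_inr_inl {X : Type*} {l n m s : ℕ+} (a : Mat l m X) (b : Mat l s X)
    (c : Mat n m X) (d : Mat n s X) (i : Idx n) (j : Idx m) :
    blocks a b c d (sumEquiv l n (.inr i)) (sumEquiv m s (.inl j)) = c i j := by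
  simp [blocks]

@[simp] theorem blocks_inr_inr {X : Type*} {l n m s : ℕ+} (a : Mat l m X) (b : Mat l s X)
    (c : Mat n m X) (d : Mat n s X) (i : Idx n) (j : Idx s) :
    blocks a b c d (sumEquiv l n (.inr i)) (sumEquiv m s (.inr j)) = d i j := by
  simp [blocks]

theorem mat_ext {X : Type*} {l n m s : ℕ+} {A B : Mat (l + n) (m + s) X}
    (h : ∀ i j, A (sumEquiv l n i) (sumEquiv m s j) = B (sumEquiv l n i) (sumEquiv m s j)) :
    A = B := by
  ext i j
  obtain ⟨i, rfl⟩ := (sumEquiv l n).surjective i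
  obtain ⟨j, rfl⟩ := (sumEquiv m s).surjective j
  exact h i j

theorem blocks_conjTranspose {X : Type*} [Star X] {l n m s : ℕ+} (a : Mat l m X) (b : Mat l s X)
    (c : Mat n m X) (d : Mat n s X) : (blocks a b c d)ᴴ = blocks aᴴ cᴴ bᴴ dᴴ := by
  apply mat_ext
  rintro (i | i) (j | j) <;> simp [Matrix.conjTranspose_apply]

theorem dsum_conjTranspose {X : Type*} [AddCommGroup X] [StarAddMonoid X] {l n m s : ℕ+}
    (x : Mat l m X) (y : Mat n s X) : (dsum x y)ᴴ = dsum xᴴ yᴴ := by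
  simp [dsum, blocks_conjTranspose]

theorem amp_add {X : Type*} [AddCommGroup X] (m n : ℕ+) (x : X) : amp (m + n) x = dsum (amp m x) (amp n x) := by
  apply mat_ext
  rintro (i | i) (j | j) <;> simp [dsum, amp, Matrix.diagonal_apply]

variable {X : Type*} [AddCommGroup X] [Module ℂ X]

theorem lmul_one {m n : ℕ+} (x : Mat m n X) : lmul 1 x = x := by
  ext i j
  simp [lmul, Matrix.one_apply]

theorem rmul_one {m n : ℕ+} (x : Mat m n X) : rmul x 1 = x := by
  ext i j
  simp [rmul, Matrix.one_apply]

theorem lmul_lmul {k l m n : ℕ+} (a : Mat k l ℂ) (b : Mat l m ℂ) (x : Mat m n X) :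
    lmul a (lmul b x) = lmul (a * b) x := by
  ext i j
  simp only [lmul, Matrix.of_apply, Matrix.mul_apply, Finset.smul_sum, Finset.sum_smul, smul_smul]
  rw [Finset.sum_comm]

theorem lmul_rmul {k l m n : ℕ+} (a : Mat k l ℂ) (x : Mat l m X) (b : Mat m n ℂ) :
    rmul (lmul a x) b = lmul a (rmul x b) := by
  ext i j
  simp only [lmul, rmul, Matrix.of_apply, Finset.smul_sum]
  rw [Finset.sum_comm]
  simp only [smul_smul, mul_comm]

theorem lmul_conjTranspose [StarAddMonoid X] [StarModule ℂ X] {l m n : ℕ+} (a : Mat l m ℂ)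
    (x : Mat m n X) : (lmul a x)ᴴ = rmul xᴴ aᴴ := by
  ext i j
  simp [lmul, rmul, Matrix.conjTranspose_apply, star_sum, star_smul]

/-- The scalar matrix of a map of indices. -/
def rowMat {m n : ℕ+} (f : Idx n → Idx m) : Mat m n ℂ :=
  Matrix.of fun a k => if a = f k then 1 else 0

theorem rowMat_isometry {m n : ℕ+} {f : Idx n → Idx m} (hf : Function.Injective f) :
    (rowMat f)ᴴ * rowMat f = 1 := by
  ext i j
  simp [rowMat, Matrix.mul_apply, Matrix.conjTranspose_apply, Matrix.one_apply, hf.eq_iff,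
    eq_comm]

theorem norm_le_one_of_isometry {m n : ℕ+} {a : Mat m n ℂ} (ha : aᴴ * a = 1) : ‖a‖ ≤ 1 := by
  have h := Matrix.l2_opNorm_conjTranspose_mul_self a
  rw [ha, CStarRing.norm_one] at h
  nlinarith [norm_nonneg a]

end Basic

namespace MatrixOrderedSpace

variable {X : Type*} [AddCommGroup X] [Module ℂ X] [StarAddMonoid X] [StarModule ℂ X]
  (S : MatrixOrderedSpace X)

theorem sum_mem {ι : Type*} {n : ℕ+} (s : Finset ι) (f : ι → Mat n n X)
    (h : ∀ i ∈ s, f i ∈ S.pos n) : ∑ i ∈ s, f i ∈ S.pos n := by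
  classical
  induction s using Finset.induction_on with
  | empty => simpa using S.zero_mem n
  | insert a s ha ih =>
    rw [Finset.sum_insert ha]
    exact S.add_mem (h a (by simp)) (ih fun i hi => h i (by simp [hi]))

theorem sub_mem {m n : ℕ+} (f : Idx m → Idx n) (c : Idx m → ℂ) {v : Mat n n X}
    (hv : v ∈ S.pos n) :
    (Matrix.of fun i j => (star (c i) * c j) • v (f i) (f j)) ∈ S.pos m := by
  have h := S.conj_mem (Matrix.of fun k i => if k = f i then c i else 0) hv
  convert h using 1
  ext i j
  simp [lmul, rmul, Matrix.conjTranspose_apply, apply_ite, ite_smul, smul_smul]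

theorem amp_mem (n : ℕ+) {x : X} (hx : amp 1 x ∈ S.pos 1) : amp n x ∈ S.pos n := by
  have h := S.sum_mem Finset.univ (fun a : Idx n => _)
    (fun a _ => S.sub_mem (fun _ : Idx n => (default : Idx 1)) (fun i => if i = a then 1 else 0) hx)
  convert h using 1
  ext i j
  rw [Matrix.sum_apply]
  simp only [amp, Matrix.diagonal_apply, Matrix.of_apply]
  by_cases h : i = j
  · subst h
    simp [apply_ite star, ite_smul]
  · simp [h, apply_ite star, ite_smul]

theorem half_mem {n : ℕ+} {v w : Mat n n X} (h : v ∈ S.pos n) (hw : v = (2 : ℂ) • w) :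
    w ∈ S.pos n := by
  have := S.smul_mem (k := 1 / 2) (by norm_num) h
  rw [hw, smul_smul] at this
  simpa using this

theorem blocks_mem {n : ℕ+} {w y : Mat n n X} (hy : y.IsHermitian) (h₁ : w + y ∈ S.pos n)
    (h₂ : w - y ∈ S.pos n) : blocks w y yᴴ w ∈ S.pos (n + n) := by
  have e₁ := S.sub_mem (fun i => Sum.elim id id ((sumEquiv n n).symm i)) (fun _ => 1) h₁
  have e₂ := S.sub_mem (fun i => Sum.elim id id ((sumEquiv n n).symm i))
    (fun i => Sum.elim (fun _ => 1) (fun _ => -1) ((sumEquiv n n).symm i)) h₂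
  refine S.half_mem (S.add_mem e₁ e₂) ?_
  rw [hy.eq]
  apply mat_ext
  rintro (i | i) (j | j) <;> simp [two_smul] <;> abel

theorem of_blocks_mem {n : ℕ+} {w y : Mat n n X} (hy : y.IsHermitian)
    (h : blocks w y yᴴ w ∈ S.pos (n + n)) (c : ℝ) (hc : c = 1 ∨ c = -1) :
    w + (c : ℂ) • y ∈ S.pos n := by
  have e := S.conj_mem (Matrix.of fun k j => Sum.elim (fun i => if i = j then 1 else 0)
    (fun i => if i = j then (c : ℂ) else 0) ((sumEquiv n n).symm k)) h
  refine S.half_mem e ?_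
  rw [hy.eq]
  ext i j
  simp only [lmul, rmul, Matrix.of_apply, ← (sumEquiv n n).sum_comp, Fintype.sum_sum_type,
    Matrix.conjTranspose_apply]
  rcases hc with rfl | rfl <;> simp [apply_ite star, ite_smul, two_smul, Finset.sum_add_distrib] <;> abel

/-- `y` belongs to `X_x`: the matrix with rows `(ε x, y)` and `(y⋆, ε x)` is positive for some
`ε > 0`. -/
def Dom (x y : X) : Prop :=
  ∃ ε : ℝ, 0 < ε ∧
    blocks (amp 1 ((ε : ℂ) • x)) (amp 1 y) (amp 1 y)ᴴ (amp 1 ((ε : ℂ) • x)) ∈ S.pos (1 + 1)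

theorem amp_smul_mem (n : ℕ+) {x : X} (hx : amp 1 x ∈ S.pos 1) {k : ℝ} (hk : 0 ≤ k) :
    amp n ((k : ℂ) • x) ∈ S.pos n := by
  have h := S.smul_mem hk (S.amp_mem n hx)
  convert h using 1
  ext i j
  simp [amp, Matrix.diagonal_apply]

theorem dom_zero {x : X} (hx : amp 1 x ∈ S.pos 1) : S.Dom x 0 := by
  refine ⟨1, one_pos, ?_⟩
  convert S.amp_smul_mem (1 + 1) hx zero_le_one using 1
  rw [amp_add]
  simp [dsum, amp]

theorem dom_add {x y z : X} (hy : S.Dom x y) (hz : S.Dom x z) : S.Dom x (y + z) := by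
  obtain ⟨ε, hε, h⟩ := hy
  obtain ⟨δ, hδ, h'⟩ := hz
  refine ⟨ε + δ, by positivity, ?_⟩
  convert S.add_mem h h' using 1
  apply mat_ext
  rintro (i | i) (j | j) <;> simp [amp, Unique.eq_default, add_smul]

theorem dom_smul {x y : X} (hx : amp 1 x ∈ S.pos 1) (z : ℂ) (hy : S.Dom x y) :
    S.Dom x (z • y) := by
  obtain ⟨ε, hε, h⟩ := hy
  refine ⟨ε * (1 + ‖z‖ ^ 2), by positivity, ?_⟩
  have h₁ := S.sub_mem id
    (fun i => Sum.elim (fun _ => 1) (fun _ => z) ((sumEquiv 1 1).symm i)) h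
  have h₂ := S.sub_mem id
    (fun i => Sum.elim (fun _ => z) (fun _ => 0) ((sumEquiv 1 1).symm i))
    (S.amp_smul_mem (1 + 1) hx hε.le)
  have h₃ := S.sub_mem id
    (fun i => Sum.elim (fun _ => 0) (fun _ => 1) ((sumEquiv 1 1).symm i))
    (S.amp_smul_mem (1 + 1) hx hε.le)
  have hz : (starRingEnd ℂ) z * z = (‖z‖ : ℂ) ^ 2 := Complex.conj_mul' z
  convert S.add_mem h₁ (S.add_mem h₂ h₃) using 1
  apply mat_ext
  rintro (i | i) (j | j) <;>
    simp [amp, Matrix.diagonal_apply, Unique.eq_default, hz, smul_smul, ← add_smul,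
      -Complex.coe_smul] <;>
    ring_nf

theorem dom_star {x y : X} (hy : S.Dom x y) : S.Dom x (star y) := by
  obtain ⟨ε, hε, h⟩ := hy
  refine ⟨ε, hε, ?_⟩
  convert S.sub_mem (fun i => sumEquiv 1 1 ((sumEquiv 1 1).symm i).swap) (fun _ => 1) h using 1
  apply mat_ext
  rintro (i | i) (j | j) <;> simp [amp, Unique.eq_default]

theorem dom_self {x : X} (hx : amp 1 x ∈ S.pos 1) : S.Dom x x := by
  refine ⟨1, one_pos, ?_⟩
  apply S.blocks_mem (S.isHermitian_of_pos hx)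
  · simpa using S.add_mem hx hx
  · simpa using S.zero_mem 1

theorem dom_mono {x y : X} (hx : amp 1 x ∈ S.pos 1) {ε δ : ℝ} (hle : ε ≤ δ)
    (h : blocks (amp 1 ((ε : ℂ) • x)) (amp 1 y) (amp 1 y)ᴴ (amp 1 ((ε : ℂ) • x)) ∈ S.pos (1 + 1)) :
    blocks (amp 1 ((δ : ℂ) • x)) (amp 1 y) (amp 1 y)ᴴ (amp 1 ((δ : ℂ) • x)) ∈ S.pos (1 + 1) := by
  convert S.add_mem h (S.amp_smul_mem (1 + 1) hx (sub_nonneg.2 hle)) using 1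
  rw [amp_add]
  apply mat_ext
  rintro (i | i) (j | j) <;>
    simp [amp, dsum, Unique.eq_default, ← add_smul, -Complex.coe_smul]

theorem exists_of_dom {x : X} (hx : amp 1 x ∈ S.pos 1) {n : ℕ+} {y : Mat n n X}
    (hy : y.IsHermitian) (h : ∀ i j, S.Dom x (y i j)) :
    ∃ ε : ℝ, 0 < ε ∧ amp n ((ε : ℂ) • x) + y ∈ S.pos n ∧ amp n ((ε : ℂ) • x) - y ∈ S.pos n := by
  choose ε hε hp using h
  let δ : ℝ := ∑ i, ∑ j, ε i j
  have hle : ∀ i j, ε i j ≤ δ := fun i j =>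
    (Finset.single_le_sum (f := fun j => ε i j) (fun j _ => (hε i j).le) (Finset.mem_univ j)).trans
      (Finset.single_le_sum (f := fun i => ∑ j, ε i j)
        (fun i _ => Finset.sum_nonneg fun j _ => (hε i j).le) (Finset.mem_univ i))
  have hδ : 0 < δ := (hε (Classical.arbitrary _) (Classical.arbitrary _)).trans_le (hle _ _)
  have key : ∀ c : ℝ, c = 1 ∨ c = -1 →
      amp n ((((n : ℕ) * δ : ℝ) : ℂ) • x) + (c : ℂ) • y ∈ S.pos n := by
    intro c hc
    have e := S.sum_mem Finset.univ (fun p : Idx n × Idx n => _) (fun p _ =>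
      S.conj_mem (Matrix.of fun k b => Sum.elim (fun _ => if b = p.1 then 1 else 0)
        (fun _ => if b = p.2 then (c : ℂ) else 0) ((sumEquiv 1 1).symm k))
        (S.dom_mono hx (hle p.1 p.2) (hp p.1 p.2)))
    refine S.half_mem e ?_
    have hcard : Fintype.card (Idx n) = n := Fintype.card_fin n
    ext a b
    have hab : star (y b a) = y a b := by
      conv_rhs => rw [← hy.eq]
      rfl
    rw [Matrix.sum_apply, Fintype.sum_prod_type]
    simp only [lmul, rmul, Matrix.of_apply, ← (sumEquiv 1 1).sum_comp, Fintype.sum_sum_type,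
      Matrix.conjTranspose_apply]
    rcases eq_or_ne a b with rfl | hne <;> rcases hc with rfl | rfl <;>
      simp [apply_ite star, ite_smul, Unique.eq_default, amp, Finset.sum_add_distrib,
        mul_smul, ← Nat.cast_smul_eq_nsmul ℂ, *, -Complex.coe_smul] <;> module
  refine ⟨(n : ℕ) * δ, by have := n.pos; positivity, ?_, ?_⟩
  · simpa using key 1 (Or.inl rfl)
  · simpa [sub_eq_add_neg] using key (-1) (Or.inr rfl)

theorem dom_of_le {x : X} {n : ℕ+} {y : Mat n n X} (hy : y.IsHermitian) {ε : ℝ} (hε : 0 < ε)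
    (h₁ : amp n ((ε : ℂ) • x) + y ∈ S.pos n) (h₂ : amp n ((ε : ℂ) • x) - y ∈ S.pos n)
    (i j : Idx n) : S.Dom x (y i j) := by
  refine ⟨ε, hε, ?_⟩
  have e₁ := S.sub_mem (fun k => Sum.elim (fun _ => i) (fun _ => j) ((sumEquiv 1 1).symm k))
    (fun _ => 1) h₁
  have e₂ := S.sub_mem (fun k => Sum.elim (fun _ => i) (fun _ => j) ((sumEquiv 1 1).symm k))
    (fun k => Sum.elim (fun _ => 1) (fun _ => -1) ((sumEquiv 1 1).symm k)) h₂
  refine S.half_mem (S.add_mem e₁ e₂) ?_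
  have hij : star (y i j) = y j i := by
    conv_rhs => rw [← hy.eq]
    rfl
  apply mat_ext
  rintro (a | a) (b | b) <;>
    simp [amp, Matrix.diagonal_apply, Unique.eq_default, two_smul, hij, eq_comm] <;> abel

end MatrixOrderedSpace

namespace AbsMatrixOrderUnitSpace

variable {X : Type*} [AddCommGroup X] [Module ℂ X] [StarAddMonoid X] [StarModule ℂ X]
  (S : AbsMatrixOrderUnitSpace X)

/-- `p` is an order projection: `p` is self-adjoint and `|2p - eⁿ| = eⁿ`. -/
def IsOrderProj {n : ℕ+} (p : Mat n n X) : Prop :=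
  p.IsHermitian ∧ S.abs ((2 : ℂ) • p - amp n S.unit) = amp n S.unit

/-- `v` is a partial isometry: `|v|` and `|v⋆|` are order projections. -/
def IsPartialIso {m n : ℕ+} (v : Mat m n X) : Prop :=
  S.IsOrderProj (S.abs v) ∧ S.IsOrderProj (S.abs vᴴ)

/-- Condition (T). -/
def CondT : Prop :=
  ∀ (l m n : ℕ+) (u : Mat m n X) (v : Mat l n X), S.IsPartialIso u → S.IsPartialIso v →
    S.abs u = S.abs v →
    ∃ w : Mat m l X, S.IsPartialIso w ∧ S.abs wᴴ = S.abs uᴴ ∧ S.abs w = S.abs vᴴ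

/-- The set of order projections of all sizes. -/
structure OPInf where
  size : ℕ+
  mat : Mat size size X
  isOrderProj : S.IsOrderProj mat

variable {S} in
/-- Partial isometric equivalence `p ∼ q` of order projections. -/
def PIEquiv (p q : S.OPInf) : Prop :=
  ∃ v : Mat p.size q.size X, p.mat = S.abs vᴴ ∧ q.mat = S.abs v

theorem antisymm {n : ℕ+} {v w : Mat n n X} (h₁ : v - w ∈ S.pos n) (h₂ : w - v ∈ S.pos n) :
    v = w := by
  have h := S.abs_smul (-1) (S.isHermitian_of_pos h₁)
  have e : (((-1 : ℝ) : ℂ)) • (v - w) = w - v := by simp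
  rw [e, S.abs_of_pos h₁, S.abs_of_pos h₂] at h
  have h' : (2 : ℂ) • (v - w) = 0 := by
    simp only [abs_neg, abs_one, Complex.ofReal_one, one_smul] at h
    rw [two_smul]
    nth_rewrite 1 [← h]
    abel
  exact sub_eq_zero.1 ((smul_eq_zero.1 h').resolve_left two_ne_zero)

theorem abs_lmul_sub_mem {m n s : ℕ+} {a : Mat m n ℂ} (ha : ‖a‖ ≤ 1) (x : Mat n s X) :
    S.abs x - S.abs (lmul a x) ∈ S.pos s := by
  have h := S.abs_mul_le a x (1 : Mat s s ℂ)
  rw [rmul_one, rmul_one, S.abs_of_pos (S.abs_mem x)] at h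
  have h' := S.smul_mem (sub_nonneg.2 ha) (S.abs_mem x)
  convert S.add_mem h h' using 1
  push_cast
  module

theorem abs_lmul_isometry {m n s : ℕ+} {a : Mat m n ℂ} (ha : aᴴ * a = 1) (x : Mat n s X) :
    S.abs (lmul a x) = S.abs x := by
  have hn := norm_le_one_of_isometry ha
  refine S.antisymm ?_ (S.abs_lmul_sub_mem hn x)
  have h := S.abs_lmul_sub_mem (a := aᴴ) (by rwa [Matrix.l2_opNorm_conjTranspose]) (lmul a x)
  rwa [lmul_lmul, ha, lmul_one] at h

theorem IsOrderProj.mem {n : ℕ+} {p : Mat n n X} (hp : S.IsOrderProj p) : p ∈ S.pos n := by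
  have hu := S.amp_mem n S.unit_pos
  have h2 : ((2 : ℂ) • p).IsHermitian := by
    rw [Matrix.IsHermitian, Matrix.conjTranspose_smul, hp.1.eq]
    simp
  have h := S.abs_add_mem (h2.sub (S.isHermitian_of_pos hu))
  rw [hp.2] at h
  exact S.half_mem h (by abel)

theorem IsOrderProj.dsum {m n : ℕ+} {p : Mat m m X} {q : Mat n n X} (hp : S.IsOrderProj p)
    (hq : S.IsOrderProj q) : S.IsOrderProj (dsum p q) := by
  refine ⟨?_, ?_⟩
  · rw [Matrix.IsHermitian, dsum_conjTranspose, hp.1.eq, hq.1.eq]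
  · have : (2 : ℂ) • AMOU.dsum p q - amp (m + n) S.unit =
        AMOU.dsum ((2 : ℂ) • p - amp m S.unit) ((2 : ℂ) • q - amp n S.unit) := by
      rw [amp_add]
      apply mat_ext
      rintro (i | i) (j | j) <;> simp [AMOU.dsum]
    rw [this, S.abs_dsum, hp.2, hq.2, amp_add]

theorem isOrderProj_zero (n : ℕ+) : S.IsOrderProj (0 : Mat n n X) := by
  refine ⟨Matrix.isHermitian_zero, ?_⟩
  have hu := S.amp_mem n S.unit_pos
  have h := S.abs_smul (-1) (S.isHermitian_of_pos hu)
  simpa [S.abs_of_pos hu] using h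

variable {S}

/-- The sum `p ⊕ q` of order projections. -/
def OPInf.sum (p q : S.OPInf) : S.OPInf where
  size := p.size + q.size
  mat := dsum p.mat q.mat
  isOrderProj := IsOrderProj.dsum S p.isOrderProj q.isOrderProj

/-- `p ≈ q`: there is an order projection `r` with `p ⊕ r ∼ q ⊕ r`. -/
def StableEquiv (p q : S.OPInf) : Prop :=
  ∃ r : S.OPInf, PIEquiv (p.sum r) (q.sum r)

/-- The zero projection of size `1`. -/
def OPInf.zero (S : AbsMatrixOrderUnitSpace X) : S.OPInf where
  size := 1
  mat := 0
  isOrderProj := S.isOrderProj_zero 1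

theorem PIEquiv.refl (p : S.OPInf) : PIEquiv p p := by
  have h := S.abs_of_pos (IsOrderProj.mem S p.isOrderProj)
  exact ⟨p.mat, by rw [p.isOrderProj.1.eq, h], h.symm⟩

theorem PIEquiv.symm {p q : S.OPInf} (h : PIEquiv p q) : PIEquiv q p := by
  obtain ⟨v, h₁, h₂⟩ := h
  exact ⟨vᴴ, by rw [Matrix.conjTranspose_conjTranspose, h₂], h₁⟩

theorem PIEquiv.trans (hT : S.CondT) {p q r : S.OPInf} (h : PIEquiv p q) (h' : PIEquiv q r) :
    PIEquiv p r := by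
  obtain ⟨v, h₁, h₂⟩ := h
  obtain ⟨w, h₃, h₄⟩ := h'
  obtain ⟨z, -, hz₁, hz₂⟩ := hT _ _ _ v wᴴ ⟨h₂ ▸ q.isOrderProj, h₁ ▸ p.isOrderProj⟩
    ⟨h₃ ▸ q.isOrderProj, by rw [Matrix.conjTranspose_conjTranspose]; exact h₄ ▸ r.isOrderProj⟩
    (h₂.symm.trans h₃)
  rw [Matrix.conjTranspose_conjTranspose] at hz₂
  exact ⟨z, h₁.trans hz₁.symm, h₄.trans hz₂.symm⟩

theorem PIEquiv.sum {p q r s : S.OPInf} (h : PIEquiv p q) (h' : PIEquiv r s) :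
    PIEquiv (p.sum r) (q.sum s) := by
  obtain ⟨v, h₁, h₂⟩ := h
  obtain ⟨w, h₃, h₄⟩ := h'
  have e₁ : dsum p.mat r.mat = S.abs (dsum v w)ᴴ := by
    rw [dsum_conjTranspose, S.abs_dsum, ← h₁, ← h₃]
  have e₂ : dsum q.mat s.mat = S.abs (dsum v w) := by
    rw [S.abs_dsum, ← h₂, ← h₄]
  exact ⟨dsum v w, e₁, e₂⟩

/-- A projection is equivalent to its copies along injective maps of indices. -/
theorem PIEquiv.of_injective {p q : S.OPInf} (f : Idx p.size → Idx q.size)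
    (hf : Function.Injective f) (h₁ : ∀ i j, q.mat (f i) (f j) = p.mat i j)
    (h₂ : ∀ a, (∀ i, f i ≠ a) → ∀ b, q.mat a b = 0) : PIEquiv q p := by
  have hp := IsOrderProj.mem S p.isOrderProj
  have hq := IsOrderProj.mem S q.isOrderProj
  have hi := rowMat_isometry hf
  have e : q.mat = lmul (rowMat f) (rmul p.mat (rowMat f)ᴴ) := by
    have h₃ : ∀ a, (∀ i, f i ≠ a) → ∀ b, q.mat b a = 0 := fun a ha b => by
      rw [← q.isOrderProj.1.eq, Matrix.conjTranspose_apply, h₂ a ha, star_zero]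
    ext a b
    simp only [lmul, rmul, rowMat, Matrix.of_apply, Matrix.conjTranspose_apply]
    by_cases ha : ∃ i, f i = a
    · obtain ⟨i, rfl⟩ := ha
      by_cases hb : ∃ j, f j = b
      · obtain ⟨j, rfl⟩ := hb
        simp [h₁, hf.eq_iff, apply_ite star]
      · have hb' : ∀ j, ¬ b = f j := fun j hj => hb ⟨j, hj.symm⟩
        simp [hb', h₃ b fun j hj => hb ⟨j, hj⟩]
    · have ha' : ∀ j, ¬ a = f j := fun j hj => ha ⟨j, hj.symm⟩
      simp [ha', h₂ a fun j hj => ha ⟨j, hj⟩]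
  refine ⟨lmul (rowMat f) p.mat, ?_, ?_⟩
  · rw [lmul_conjTranspose, p.isOrderProj.1.eq, ← S.abs_lmul_isometry hi, ← e, S.abs_of_pos hq]
  · rw [S.abs_lmul_isometry hi, S.abs_of_pos hp]

theorem PIEquiv.sum_comm (p q : S.OPInf) : PIEquiv (p.sum q) (q.sum p) := by
  let f : Idx (q.size + p.size) ≃ Idx (p.size + q.size) :=
    (sumEquiv _ _).symm.trans <| (Equiv.sumComm _ _).trans (sumEquiv _ _)
  refine PIEquiv.of_injective f f.injective ?_ ?_
  · intro i j
    obtain ⟨i, rfl⟩ := (sumEquiv q.size p.size).surjective i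
    obtain ⟨j, rfl⟩ := (sumEquiv q.size p.size).surjective j
    rcases i with i | i <;> rcases j with j | j <;> simp [f, OPInf.sum, dsum]
  · intro a ha
    exact absurd (f.apply_symm_apply a) (ha _)

theorem PIEquiv.sum_zero (p : S.OPInf) : PIEquiv (p.sum (OPInf.zero S)) p := by
  refine PIEquiv.of_injective (fun i => sumEquiv p.size 1 (.inl i)) ?_ ?_ ?_
  · exact (sumEquiv p.size 1).injective.comp Sum.inl_injective
  · intro i j
    exact blocks_inl_inl _ _ _ _ _ _
  · intro a ha b
    obtain ⟨a, rfl⟩ := (sumEquiv p.size 1).surjective a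
    obtain ⟨b, rfl⟩ := (sumEquiv p.size 1).surjective b
    rcases a with a | a
    · exact absurd rfl (ha a)
    · rcases b with b | b
      · exact blocks_inr_inl _ _ _ _ _ _
      · exact blocks_inr_inr _ _ _ _ _ _

theorem PIEquiv.sum_assoc (p q r : S.OPInf) :
    PIEquiv ((p.sum q).sum r) (p.sum (q.sum r)) := by
  let f : Idx (p.size + (q.size + r.size)) ≃ Idx (p.size + q.size + r.size) :=
    (sumEquiv _ _).symm.trans <| (Equiv.sumCongr (Equiv.refl _) (sumEquiv _ _).symm).trans <|
      (Equiv.sumAssoc _ _ _).symm.trans <|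
      (Equiv.sumCongr (sumEquiv _ _) (Equiv.refl _)).trans (sumEquiv _ _)
  refine PIEquiv.of_injective f f.injective ?_ ?_
  · intro i j
    obtain ⟨i, rfl⟩ := (sumEquiv p.size (q.size + r.size)).surjective i
    obtain ⟨j, rfl⟩ := (sumEquiv p.size (q.size + r.size)).surjective j
    rcases i with i | i
    · rcases j with j | j
      · simp [f, OPInf.sum, dsum]
      · obtain ⟨j, rfl⟩ := (sumEquiv q.size r.size).surjective j
        rcases j with j | j <;> simp [f, OPInf.sum, dsum]
    · obtain ⟨i, rfl⟩ := (sumEquiv q.size r.size).surjective i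
      rcases j with j | j
      · rcases i with i | i <;> simp [f, OPInf.sum, dsum]
      · obtain ⟨j, rfl⟩ := (sumEquiv q.size r.size).surjective j
        rcases i with i | i <;> rcases j with j | j <;> simp [f, OPInf.sum, dsum]
  · intro a ha
    exact absurd (f.apply_symm_apply a) (ha _)

/-- Under (T), `∼` is an equivalence relation. -/
def piSetoid (hT : S.CondT) : Setoid S.OPInf where
  r := PIEquiv
  iseqv := ⟨PIEquiv.refl, PIEquiv.symm, PIEquiv.trans hT⟩

/-- The set of classes of order projections for `∼`. -/
def OPClass (hT : S.CondT) : Type _ := Quotient (piSetoid hT)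

/-- The class of an order projection. -/
def OPClass.mk (hT : S.CondT) (p : S.OPInf) : OPClass hT := Quotient.mk (piSetoid hT) p

instance (hT : S.CondT) : Add (OPClass hT) :=
  ⟨Quotient.map₂ OPInf.sum fun _ _ h _ _ h' => PIEquiv.sum h h'⟩

instance (hT : S.CondT) : Zero (OPClass hT) := ⟨OPClass.mk hT (OPInf.zero S)⟩

/-- Classes of order projections form a commutative monoid under `⊕`. -/
instance (hT : S.CondT) : AddCommMonoid (OPClass hT) where
  add_assoc := by
    rintro ⟨p⟩ ⟨q⟩ ⟨r⟩
    exact Quotient.sound (PIEquiv.sum_assoc p q r)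
  add_comm := by
    rintro ⟨p⟩ ⟨q⟩
    exact Quotient.sound (PIEquiv.sum_comm p q)
  zero_add := by
    rintro ⟨p⟩
    exact Quotient.sound
      (PIEquiv.trans hT (PIEquiv.sum_comm (OPInf.zero S) p) (PIEquiv.sum_zero p))
  add_zero := by
    rintro ⟨p⟩
    exact Quotient.sound (PIEquiv.sum_zero p)
  nsmul := nsmulRec

/-- The group `K₀`: the Grothendieck group of the monoid of classes of order projections. -/
abbrev K0 (hT : S.CondT) : Type _ := Algebra.GrothendieckAddGroup (OPClass hT)

/-- The element `[(p, q)]` of `K₀`. -/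
def K0.mk (hT : S.CondT) (p q : S.OPInf) : K0 hT :=
  AddLocalization.mk (OPClass.mk hT p) ⟨OPClass.mk hT q, AddSubmonoid.mem_top _⟩

/-- `K₀` consists of pairs of order projections modulo `(p, q) ≡ (r, s) ↔ p ⊕ s ≈ r ⊕ q`. -/
theorem K0.mk_eq_mk_iff (hT : S.CondT) (p q r s : S.OPInf) :
    K0.mk hT p q = K0.mk hT r s ↔ StableEquiv (p.sum s) (r.sum q) := by
  unfold K0.mk
  rw [AddLocalization.mk_eq_mk_iff, AddLocalization.r_iff_exists]
  constructor
  · rintro ⟨⟨⟨c⟩, hc⟩, h⟩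
    have h' : OPClass.mk hT p + OPClass.mk hT s + OPClass.mk hT c =
        OPClass.mk hT r + OPClass.mk hT q + OPClass.mk hT c := by
      rw [add_comm (OPClass.mk hT p), add_comm (OPClass.mk hT r), add_comm _ (OPClass.mk hT c),
        add_comm _ (OPClass.mk hT c)]
      exact h
    exact ⟨c, Quotient.exact h'⟩
  · rintro ⟨c, h⟩
    have h' : OPClass.mk hT p + OPClass.mk hT s + OPClass.mk hT c =
        OPClass.mk hT r + OPClass.mk hT q + OPClass.mk hT c := Quotient.sound h
    refine ⟨⟨OPClass.mk hT c, AddSubmonoid.mem_top _⟩, ?_⟩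
    rw [add_comm (OPClass.mk hT p), add_comm (OPClass.mk hT r), add_comm _ (OPClass.mk hT c),
      add_comm _ (OPClass.mk hT c)] at h'
    exact h'

/-- `x` has the absolute matrix order unit property: `x ≥ 0` and, for all `n`,
`|y| ≤ ‖y‖ xⁿ` for every self-adjoint `y` with `± y ≤ ε xⁿ` for some `ε > 0`. -/
def HasAbsMatrixOrderUnitProperty (S : AbsMatrixOrderUnitSpace X) (x : X) : Prop :=
  amp 1 x ∈ S.pos 1 ∧ ∀ (n : ℕ+) (y : Mat n n X), y.IsHermitian →
    (∃ ε : ℝ, 0 < ε ∧ amp n ((ε : ℂ) • x) + y ∈ S.pos n ∧ amp n ((ε : ℂ) • x) - y ∈ S.pos n) →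
    amp n ((S.matNorm y : ℂ) • x) - S.abs y ∈ S.pos n

end AbsMatrixOrderUnitSpace

section Ideal

variable {X : Type*} [AddCommGroup X] [Module ℂ X] [StarAddMonoid X] [StarModule ℂ X]

/-- The subspace `X_x` of `X`, for `x ≥ 0`. -/
def MatrixOrderedSpace.sub (S : MatrixOrderedSpace X) (x : X) (hx : amp 1 x ∈ S.pos 1) :
    Submodule ℂ X where
  carrier := {y | S.Dom x y}
  add_mem' := S.dom_add
  zero_mem' := S.dom_zero hx
  smul_mem' z _ hy := S.dom_smul hx z hy

variable {S : MatrixOrderedSpace X} {x : X} {hx : amp 1 x ∈ S.pos 1}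

instance : StarAddMonoid (S.sub x hx) where
  star y := ⟨star (y : X), S.dom_star y.2⟩
  star_involutive y := Subtype.ext (star_star (y : X))
  star_add y z := Subtype.ext (star_add (y : X) z)

instance : StarModule ℂ (S.sub x hx) where
  star_smul z y := Subtype.ext (star_smul z (y : X))

/-- A matrix over `X_x` as a matrix over `X`. -/
def emb {m n : ℕ+} (y : Mat m n (S.sub x hx)) : Mat m n X := y.map Subtype.val

section

variable {k l m n : ℕ+}

theorem emb_injective : Function.Injective (emb : Mat m n (S.sub x hx) → Mat m n X) :=
  Matrix.map_injective Subtype.val_injective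

theorem emb_add (y z : Mat m n (S.sub x hx)) : emb (y + z) = emb y + emb z := rfl

theorem emb_sub (y z : Mat m n (S.sub x hx)) : emb (y - z) = emb y - emb z := rfl

theorem emb_smul (c : ℂ) (y : Mat m n (S.sub x hx)) : emb (c • y) = c • emb y := rfl

theorem emb_zero : emb (0 : Mat m n (S.sub x hx)) = 0 := rfl

theorem emb_conjTranspose (y : Mat m n (S.sub x hx)) : emb yᴴ = (emb y)ᴴ := rfl

theorem emb_lmul (a : Mat l m ℂ) (y : Mat m n (S.sub x hx)) : emb (lmul a y) = lmul a (emb y) := by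
  ext i j
  simp [emb, lmul]

theorem emb_rmul (y : Mat m n (S.sub x hx)) (a : Mat n l ℂ) : emb (rmul y a) = rmul (emb y) a := by
  ext i j
  simp [emb, rmul]

theorem emb_blocks (a : Mat k m (S.sub x hx)) (b : Mat k n (S.sub x hx))
    (c : Mat l m (S.sub x hx)) (d : Mat l n (S.sub x hx)) :
    emb (blocks a b c d) = blocks (emb a) (emb b) (emb c) (emb d) := by
  apply mat_ext
  rintro (i | i) (j | j) <;> simp [emb]

theorem emb_dsum (a : Mat k m (S.sub x hx)) (d : Mat l n (S.sub x hx)) :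
    emb (dsum a d) = dsum (emb a) (emb d) :=
  emb_blocks a 0 0 d

theorem emb_amp (y : S.sub x hx) : emb (amp n y) = amp n (y : X) := by
  ext i j
  by_cases h : i = j <;> simp [emb, amp, h]

theorem emb_isHermitian {y : Mat n n (S.sub x hx)} : (emb y).IsHermitian ↔ y.IsHermitian :=
  ⟨fun h => emb_injective h.eq, fun h => congrArg emb h.eq⟩

theorem exists_emb {y : Mat m n X} (h : ∀ i j, S.Dom x (y i j)) :
    ∃ z : Mat m n (S.sub x hx), emb z = y :=
  ⟨Matrix.of fun i j => ⟨y i j, h i j⟩, rfl⟩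

end

/-- `X_x` as a matrix ordered space. -/
def MatrixOrderedSpace.ideal (S : MatrixOrderedSpace X) (x : X) (hx : amp 1 x ∈ S.pos 1) :
    MatrixOrderedSpace (S.sub x hx) where
  pos n := {y | emb y ∈ S.pos n}
  isHermitian_of_pos h := emb_isHermitian.1 (S.isHermitian_of_pos h)
  zero_mem n := S.zero_mem n
  add_mem h h' := S.add_mem h h'
  smul_mem hk h := S.smul_mem hk h
  conj_mem a h := by
    change emb (lmul aᴴ (rmul _ a)) ∈ S.pos _
    rw [emb_lmul, emb_rmul]
    exact S.conj_mem a h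

/-- `X_x` as a matrix order unit space with order unit `x`. -/
def MatrixOrderUnitSpace.ideal (S : MatrixOrderUnitSpace X) (x : X) (hx : amp 1 x ∈ S.pos 1) :
    MatrixOrderUnitSpace (S.toMatrixOrderedSpace.sub x hx) where
  toMatrixOrderedSpace := S.toMatrixOrderedSpace.ideal x hx
  unit := ⟨x, S.dom_self hx⟩
  unit_pos := by
    simpa [MatrixOrderedSpace.ideal, emb_amp] using hx
  order_unit y hy := by
    have hy' : (amp 1 (y : X)).IsHermitian := by
      have h : star (y : X) = y := congrArg Subtype.val hy.star_eq
      simp [Matrix.IsHermitian, amp, Matrix.diagonal_conjTranspose, Pi.star_def, h]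
    obtain ⟨ε, hε, h₁, h₂⟩ := S.exists_of_dom hx hy' (fun i j => by
      have h : S.Dom x (y : X) := y.2
      simpa [amp, Unique.eq_default] using h)
    refine ⟨ε, hε, ?_, ?_⟩
    · change emb _ ∈ S.pos 1
      rw [emb_amp]
      convert h₁ using 1
      simp [amp]
    · change emb _ ∈ S.pos 1
      rw [emb_amp]
      convert h₂ using 1
      simp [amp]
  proper y h₁ h₂ := by
    change emb _ ∈ S.pos 1 at h₁ h₂
    rw [emb_amp] at h₁ h₂
    exact Subtype.ext (S.proper y h₁ h₂)
  archimedean hu hv h := S.archimedean hu (emb_isHermitian.2 hv) h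

end Ideal

namespace AbsMatrixOrderUnitSpace

variable {X : Type*} [AddCommGroup X] [Module ℂ X] [StarAddMonoid X] [StarModule ℂ X]
  (S : AbsMatrixOrderUnitSpace X)

theorem abs_blocks {l m : ℕ+} (y : Mat l m X) :
    S.abs (blocks 0 y yᴴ 0) = dsum (S.abs yᴴ) (S.abs y) := by
  rw [← S.abs_dsum]
  let f : Idx (m + l) ≃ Idx (l + m) :=
    (sumEquiv _ _).symm.trans <| (Equiv.sumComm _ _).trans (sumEquiv _ _)
  rw [← S.abs_lmul_isometry (rowMat_isometry f.injective)]
  congr 1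
  apply mat_ext
  rintro (i | i) (j | j) <;>
    simp [lmul, rowMat, f, ← (sumEquiv m l).sum_comp, dsum, ite_smul]

variable {S} in
theorem HasAbsMatrixOrderUnitProperty.abs_dom {x : X} (hx : S.HasAbsMatrixOrderUnitProperty x)
    {l m : ℕ+} {y : Mat l m X} (hy : ∀ i j, S.Dom x (y i j)) (i j : Idx m) :
    S.Dom x (S.abs y i j) := by
  have hz : (blocks 0 y yᴴ 0).IsHermitian := by
    simp [Matrix.IsHermitian, blocks_conjTranspose]
  have hd : ∀ i j, S.Dom x (blocks 0 y yᴴ 0 i j) := by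
    intro i j
    obtain ⟨i, rfl⟩ := (sumEquiv l m).surjective i
    obtain ⟨j, rfl⟩ := (sumEquiv l m).surjective j
    rcases i with i | i <;> rcases j with j | j <;>
      simp [S.dom_zero hx.1, hy, S.dom_star]
  have h := hx.2 _ _ hz (S.exists_of_dom hx.1 hz hd)
  rw [S.abs_blocks] at h
  set c := S.matNorm (blocks 0 y yᴴ 0)
  have hc : 0 ≤ c := Real.sInf_nonneg fun ε hε => hε.1.le
  have h' := S.sub_mem (fun k : Idx m => sumEquiv l m (.inr k)) (fun _ => 1) h
  have e : amp m ((c : ℂ) • x) - S.abs y ∈ S.pos m := by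
    convert h' using 1
    ext a b
    simp [amp_add, dsum]
  have hm := S.abs_mem y
  have hxm := S.amp_mem m hx.1
  have e₁ : amp m (((c + 1 : ℝ) : ℂ) • x) = amp m ((c : ℂ) • x) + amp m x := by
    ext a b
    by_cases h : a = b <;> simp [amp, h, add_smul]
  refine S.dom_of_le (S.isHermitian_of_pos hm) (ε := c + 1) (by positivity) ?_ ?_ i j
  · exact S.add_mem (S.amp_smul_mem m hx.1 (by positivity)) hm
  · rw [e₁]
    convert S.add_mem e hxm using 1
    abel

theorem dom_of_pos_le {x : X} (hx : amp 1 x ∈ S.pos 1) {n : ℕ+} {u v : Mat n n X}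
    (hu : u ∈ S.pos n) (h : v - u ∈ S.pos n) (hv : ∀ i j, S.Dom x (v i j)) (i j : Idx n) :
    S.Dom x (u i j) := by
  have hvp : v ∈ S.pos n := by simpa using S.add_mem h hu
  obtain ⟨ε, hε, -, h₂⟩ := S.exists_of_dom hx (S.isHermitian_of_pos hvp) hv
  refine S.dom_of_le (S.isHermitian_of_pos hu) hε ?_ ?_ i j
  · exact S.add_mem (S.amp_smul_mem n hx hε.le) hu
  · simpa using S.add_mem h₂ h

theorem unit_sub_mem {x : X} (hx : amp 1 x ∈ S.pos 1) (h1 : S.matNorm (amp 1 x) = 1) :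
    amp 1 (S.unit - x) ∈ S.pos 1 := by
  have hxh := S.isHermitian_of_pos hx
  have hu := S.isHermitian_of_pos S.unit_pos
  have e : ∀ y z : X, amp 1 (y - z) = amp 1 y - amp 1 z := fun y z => by simp [amp]
  rw [e]
  refine S.archimedean S.unit_pos (hu.sub hxh) fun k hk => ?_
  have hne : {ε : ℝ | 0 < ε ∧ blocks (amp 1 ((ε : ℂ) • S.unit)) (amp 1 x) (amp 1 x)ᴴ
      (amp 1 ((ε : ℂ) • S.unit)) ∈ S.pos (1 + 1)}.Nonempty := by
    by_contra h
    rw [Set.not_nonempty_iff_eq_empty] at h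
    rw [MatrixOrderUnitSpace.matNorm, h, Real.sInf_empty] at h1
    exact zero_ne_one h1
  obtain ⟨ε, ⟨hε, hb⟩, hlt⟩ := exists_lt_of_csInf_lt hne
    (show S.matNorm (amp 1 x) < 1 + k by linarith)
  have h := S.of_blocks_mem hxh hb (-1) (Or.inr rfl)
  convert S.add_mem h (S.amp_smul_mem 1 S.unit_pos (sub_nonneg.2 hlt.le)) using 1
  ext a b
  simp [amp, Unique.eq_default, -Complex.coe_smul]
  module

theorem matNorm_ideal {x : X} (hx : S.HasAbsMatrixOrderUnitProperty x)
    (h1 : S.matNorm (amp 1 x) = 1) {n : ℕ+}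
    (y : Mat n n (S.toMatrixOrderedSpace.sub x hx.1)) (hy : y.IsHermitian) :
    (S.toMatrixOrderUnitSpace.ideal x hx.1).matNorm y = S.matNorm (emb y) := by
  have hy' := emb_isHermitian.2 hy
  obtain ⟨ε₀, hε₀, h₁, h₂⟩ := S.exists_of_dom hx.1 hy' fun i j => (y i j).2
  have habs := hx.2 n (emb y) hy' ⟨ε₀, hε₀, h₁, h₂⟩
  have hset : {ε : ℝ | 0 < ε ∧ blocks (amp n ((ε : ℂ) •
        (S.toMatrixOrderUnitSpace.ideal x hx.1).unit)) y yᴴ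
        (amp n ((ε : ℂ) • (S.toMatrixOrderUnitSpace.ideal x hx.1).unit)) ∈
        (S.toMatrixOrderUnitSpace.ideal x hx.1).pos (n + n)} =
      {ε : ℝ | 0 < ε ∧ blocks (amp n ((ε : ℂ) • x)) (emb y) (emb y)ᴴ
        (amp n ((ε : ℂ) • x)) ∈ S.pos (n + n)} := by
    ext ε
    refine and_congr_right fun _ => ?_
    change emb _ ∈ S.pos _ ↔ _
    rw [emb_blocks, emb_amp, emb_conjTranspose]
    rfl
  have hnn : 0 ≤ S.matNorm (emb y) := Real.sInf_nonneg fun ε hε => hε.1.le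
  apply le_antisymm
  · refine le_of_forall_pos_le_add fun k hk => ?_
    rw [MatrixOrderUnitSpace.matNorm, hset]
    refine csInf_le ⟨0, fun ε hε => hε.1.le⟩ ⟨by positivity, ?_⟩
    have hk' := S.amp_smul_mem n hx.1 hk.le
    have e : amp n (((S.matNorm (emb y) + k : ℝ) : ℂ) • x) =
        amp n ((S.matNorm (emb y) : ℂ) • x) + amp n ((k : ℂ) • x) := by
      ext a b
      by_cases h : a = b <;> simp [amp, h, add_smul]
    refine S.blocks_mem hy' ?_ ?_
    · rw [e]
      convert S.add_mem (S.add_mem habs (S.abs_add_mem hy')) hk' using 1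
      abel
    · rw [e]
      convert S.add_mem (S.add_mem habs (S.abs_sub_mem hy')) hk' using 1
      abel
  · rw [MatrixOrderUnitSpace.matNorm, MatrixOrderUnitSpace.matNorm, hset]
    refine csInf_le_csInf ⟨0, fun ε hε => hε.1.le⟩ ⟨ε₀, hε₀, S.blocks_mem hy' h₁ h₂⟩ ?_
    rintro ε ⟨hε, h⟩
    refine ⟨hε, ?_⟩
    convert S.add_mem h (S.amp_smul_mem (n + n) (S.unit_sub_mem hx.1 h1) hε.le) using 1
    rw [amp_add]
    apply mat_ext
    rintro (i | i) (j | j) <;> simp only [blocks_inl_inl, blocks_inl_inr, blocks_inr_inl,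
      blocks_inr_inr, Matrix.add_apply, dsum, Matrix.zero_apply, add_zero] <;>
      by_cases h : i = j <;> simp [amp, h, smul_sub]

/-- `X_x` as an absolute matrix order unit space, with the cones and absolute values of `X` and
the order unit `x`, for `x` of norm `1` with the absolute matrix order unit property. -/
def ideal (x : X) (hx : S.HasAbsMatrixOrderUnitProperty x) (h1 : S.matNorm (amp 1 x) = 1) :
    AbsMatrixOrderUnitSpace (S.toMatrixOrderedSpace.sub x hx.1) where
  toMatrixOrderUnitSpace := S.toMatrixOrderUnitSpace.ideal x hx.1
  abs y := Matrix.of fun i j => ⟨S.abs (emb y) i j, hx.abs_dom (fun a b => (y a b).2) i j⟩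
  abs_mem y := S.abs_mem (emb y)
  abs_of_pos h := emb_injective (S.abs_of_pos h)
  abs_add_mem h := S.abs_add_mem (emb_isHermitian.2 h)
  abs_sub_mem h := S.abs_sub_mem (emb_isHermitian.2 h)
  abs_smul k h := emb_injective (S.abs_smul k (emb_isHermitian.2 h))
  orth_of_le hu hv hw h h₁ h₂ := emb_injective (S.orth_of_le (emb_isHermitian.2 hu)
    (emb_isHermitian.2 hv) (emb_isHermitian.2 hw) (congrArg emb h) h₁ h₂)
  orth_abs_add hu hv hw h h' := emb_injective (S.orth_abs_add (emb_isHermitian.2 hu)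
    (emb_isHermitian.2 hv) (emb_isHermitian.2 hw) (congrArg emb h) (congrArg emb h'))
  orth_abs_sub hu hv hw h h' := emb_injective (S.orth_abs_sub (emb_isHermitian.2 hu)
    (emb_isHermitian.2 hv) (emb_isHermitian.2 hw) (congrArg emb h) (congrArg emb h'))
  abs_mul_le a y b := by
    have h := S.abs_mul_le a (emb y) b
    rw [← emb_rmul, ← emb_lmul] at h
    change (‖a‖ : ℂ) • S.abs (emb (rmul _ b)) - S.abs (emb (lmul a (rmul y b))) ∈ S.pos _
    rw [emb_rmul (x := x) _ b]
    exact h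
  abs_dsum y z := by
    refine emb_injective (Eq.trans ?_ (emb_dsum _ _).symm)
    change S.abs (emb (dsum y z)) = dsum (S.abs (emb y)) (S.abs (emb z))
    rw [emb_dsum, S.abs_dsum]
  orth_iff {n u v} hu hv := by
    have hu' := emb_isHermitian.1 (S.isHermitian_of_pos hu)
    refine (emb_injective.eq_iff (f := emb)).symm.trans ((S.orth_iff hu hv).trans ?_)
    have hs : ∀ (k : ℝ) (y : Mat n n (S.toMatrixOrderedSpace.sub x hx.1)), y.IsHermitian →
        ((k : ℂ) • y).IsHermitian := fun k y hy => by
      rw [Matrix.IsHermitian, Matrix.conjTranspose_smul, hy.eq]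
      simp
    have key : ∀ u₁ v₁ : Mat n n (S.toMatrixOrderedSpace.sub x hx.1), emb u₁ ∈ S.pos n →
        emb v₁ ∈ S.pos n → (S.OrthInf (emb u₁) (emb v₁) ↔
          (S.toMatrixOrderUnitSpace.ideal x hx.1).OrthInf u₁ v₁) := by
      intro u₁ v₁ h h'
      have h := emb_isHermitian.1 (S.isHermitian_of_pos h)
      have h' := emb_isHermitian.1 (S.isHermitian_of_pos h')
      refine forall_congr' fun α => forall_congr' fun β => ?_
      rw [S.matNorm_ideal hx h1 _ ((hs α _ h).add (hs β _ h')), S.matNorm_ideal hx h1 _ (hs α _ h),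
        S.matNorm_ideal hx h1 _ (hs β _ h')]
      rfl
    constructor
    · intro H u₁ v₁ h₁ h₂ h₃ h₄
      exact (key u₁ v₁ h₁ h₃).1 (H _ _ h₁ h₂ h₃ h₄)
    · intro H u₁ v₁ h₁ h₂ h₃ h₄
      obtain ⟨u₁, rfl⟩ := exists_emb (hx := hx.1) (S.dom_of_pos_le hx.1 h₁ h₂ fun i j => (u i j).2)
      obtain ⟨v₁, rfl⟩ := exists_emb (hx := hx.1) (S.dom_of_pos_le hx.1 h₃ h₄ fun i j => (v i j).2)
      exact (key u₁ v₁ h₁ h₃).2 (H _ _ h₁ h₂ h₃ h₄)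

variable {S} in
/-- The inclusion of the order projections of `X_x` into those of `X`: the same matrix,
regarded over `X`. -/
def OPInf.incl {x : X} {hx : S.HasAbsMatrixOrderUnitProperty x} {h1 : S.matNorm (amp 1 x) = 1}
    (hOP : ∀ (n : ℕ+) (p : Mat n n (S.toMatrixOrderedSpace.sub x hx.1)),
      (S.ideal x hx h1).IsOrderProj p → S.IsOrderProj (emb p))
    (p : (S.ideal x hx h1).OPInf) : S.OPInf where
  size := p.size
  mat := emb p.mat
  isOrderProj := hOP p.size p.mat p.isOrderProj

end AbsMatrixOrderUnitSpace

end AMOU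

namespace AMOU

/-! The heart of the matter is that `x` is itself an order projection of `X`. Split `x - e/2 = a -
b` into orthogonal positive parts. Since `b ≤ e/2 + a` and `a ⊥ b`, in fact `b ≤ e/2`
(`le_smul_unit_of_orth`): orthogonal elements are independent for the norm, so `a` cannot help to
dominate `b`. Hence `u = e/2 - b = x - a` satisfies `0 ≤ u ≤ x` and `‖u‖ ≤ 1/2`. The absolute matrix
order unit property now gives `u ≤ x/2`, that is, `x/2 ≤ a` and `(e - x)/2 ≤ b`. Orthogonality is
inherited by smaller positive elements, so `x ⊥ e - x`, which says `|2x - e| = e`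
(`isOrderProj_amp_one`).

An order projection `p` of `X_x` is orthogonal to `xⁿ - p`, and, lying below `xⁿ`, it is also
orthogonal to `eⁿ - xⁿ`. It is therefore orthogonal to their sum `eⁿ - p`, so it is an order
projection of `X` (`IsOrderProj.emb`).

For (T), a witness over `X` already has its entries in `X_x`, because `|w|` and `|w⋆|` do and they
control `w` (`dom_of_abs`). Partial isometries over `X_x` thus remain such over `X`, the inclusion
respects `∼` and `⊕`, and the universal property of the Grothendieck group yields the homomorphism.
Equality in `K₀` is a stable equivalence, so reflecting `≈` is enough for injectivity. -/

theorem amp_smul {X : Type*} [AddCommGroup X] [Module ℂ X] (n : ℕ+) (c : ℂ) (y : X) :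
    amp n (c • y) = c • amp n y := by
  ext i j
  by_cases h : i = j <;> simp [amp, h]

theorem amp_sub {X : Type*} [AddCommGroup X] (n : ℕ+) (y z : X) :
    amp n (y - z) = amp n y - amp n z := by
  ext i j
  by_cases h : i = j <;> simp [amp, h]

theorem isHermitian_ofReal_smul {X : Type*} [AddCommGroup X] [Module ℂ X] [StarAddMonoid X]
    [StarModule ℂ X] {n : ℕ+} (k : ℝ) {y : Mat n n X} (hy : y.IsHermitian) :
    ((k : ℂ) • y).IsHermitian := by
  rw [Matrix.IsHermitian, Matrix.conjTranspose_smul, hy.eq]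
  simp

/-! ### Order bounds and the order unit norm -/

namespace MatrixOrderUnitSpace

variable {X : Type*} [AddCommGroup X] [Module ℂ X] [StarAddMonoid X] [StarModule ℂ X]
  (S : MatrixOrderUnitSpace X)

theorem matNorm_nonneg {n : ℕ+} (y : Mat n n X) : 0 ≤ S.matNorm y :=
  Real.sInf_nonneg fun _ hε => hε.1.le

theorem matNorm_le_of_pos_le {n : ℕ+} {y : Mat n n X} {t : ℝ} (ht : 0 < t) (hy : y ∈ S.pos n)
    (h : (t : ℂ) • amp n S.unit - y ∈ S.pos n) : S.matNorm y ≤ t := by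
  refine csInf_le ⟨0, fun ε hε => hε.1.le⟩ ⟨ht, ?_⟩
  rw [amp_smul]
  exact S.blocks_mem (S.isHermitian_of_pos hy)
    (S.add_mem (S.smul_mem ht.le (S.amp_mem n S.unit_pos)) hy) h

/-- A self-adjoint element is dominated by a multiple of the order unit. -/
theorem exists_smul_unit_bounds {y : Mat 1 1 X} (hy : y.IsHermitian) :
    ∃ ε : ℝ, 0 < ε ∧ (ε : ℂ) • amp 1 S.unit + y ∈ S.pos 1 ∧
      (ε : ℂ) • amp 1 S.unit - y ∈ S.pos 1 := by
  obtain ⟨ε, hε, h₁, h₂⟩ := S.order_unit (y default default) (congrFun₂ hy.eq default default)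
  refine ⟨ε, hε, ?_, ?_⟩
  · convert h₁ using 1
    ext i j
    simp [amp, Unique.eq_default]
  · convert h₂ using 1
    ext i j
    simp [amp, Unique.eq_default]

/-- The infimum defining the norm is attained as an order bound: the bound holds with `‖y‖ + k` for
every `k > 0`, and the cone is Archimedean. -/
theorem matNorm_smul_unit_sub_mem {y : Mat 1 1 X} (hy : y.IsHermitian) :
    (S.matNorm y : ℂ) • amp 1 S.unit - y ∈ S.pos 1 := by
  have hu := S.isHermitian_of_pos S.unit_pos
  obtain ⟨δ, hδ, h₁, h₂⟩ := S.exists_smul_unit_bounds hy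
  refine S.archimedean S.unit_pos ((isHermitian_ofReal_smul _ hu).sub hy) fun k hk => ?_
  -- A real infimum over the empty set is `0` by convention, so the norm yields an admissible `ε`
  -- only once the set is known to be nonempty.
  have hne : {ε : ℝ | 0 < ε ∧ blocks (amp 1 ((ε : ℂ) • S.unit)) y yᴴ
      (amp 1 ((ε : ℂ) • S.unit)) ∈ S.pos (1 + 1)}.Nonempty :=
    ⟨δ, hδ, by rw [amp_smul]; exact S.blocks_mem hy h₁ h₂⟩
  obtain ⟨ε, ⟨hε, hb⟩, hlt⟩ := exists_lt_of_csInf_lt hne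
    (show S.matNorm y < S.matNorm y + k by linarith)
  have h := S.of_blocks_mem hy hb (-1) (Or.inr rfl)
  rw [amp_smul] at h
  convert S.add_mem h (S.smul_mem (sub_nonneg.2 hlt.le) S.unit_pos) using 1
  push_cast
  module

end MatrixOrderUnitSpace

/-! ### Orthogonality, and `x` as an order projection -/

namespace AbsMatrixOrderUnitSpace

variable {X : Type*} [AddCommGroup X] [Module ℂ X] [StarAddMonoid X] [StarModule ℂ X]
  (S : AbsMatrixOrderUnitSpace X)

theorem orth_comm {n : ℕ+} {u v : Mat n n X} (hu : u.IsHermitian) (hv : v.IsHermitian)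
    (h : S.abs (u - v) = u + v) : S.abs (v - u) = v + u := by
  have e := S.abs_smul (-1) (hu.sub hv)
  simpa [h, add_comm] using e

/-- If `a ⊥ b` and `b ≤ t e + a` then `b ≤ t e`. -/
theorem le_smul_unit_of_orth {a b : Mat 1 1 X} (ha : a ∈ S.pos 1) (hb : b ∈ S.pos 1)
    (hab : S.abs (a - b) = a + b) {t : ℝ} (ht : 0 ≤ t)
    (h : (t : ℂ) • amp 1 S.unit + a - b ∈ S.pos 1) :
    (t : ℂ) • amp 1 S.unit - b ∈ S.pos 1 := by
  have hbh := S.isHermitian_of_pos hb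
  have hah := S.isHermitian_of_pos ha
  have hbn := S.matNorm_smul_unit_sub_mem hbh
  suffices hle : S.matNorm b ≤ t by
    convert S.add_mem hbn (S.smul_mem (sub_nonneg.2 hle) S.unit_pos) using 1
    push_cast
    module
  -- The case `‖b‖ = 0` is set apart because the scaling factor `c` chosen below must be positive.
  rcases (S.matNorm_nonneg b).eq_or_lt with h0 | h0
  · rwa [← h0]
  obtain ⟨K, hK, -, hKa⟩ := S.exists_smul_unit_bounds hah
  -- With `a ≤ K e`, this `c` makes `‖c a‖ ≤ c K = ‖b‖`, so that `max ‖c a‖ ‖b‖ = ‖b‖`.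
  set c : ℝ := S.matNorm b / K with hc
  have hc0 : 0 < c := div_pos h0 hK
  have hcK : c * K = S.matNorm b := div_mul_cancel₀ _ hK.ne'
  have hca : S.matNorm ((c : ℂ) • a) ≤ S.matNorm b := by
    refine S.matNorm_le_of_pos_le h0 (S.smul_mem hc0.le ha) ?_
    convert S.smul_mem hc0.le hKa using 1
    rw [← hcK]
    push_cast
    module
  -- Norm orthogonality with coefficients `c` and `1` gives `‖c a + b‖ = ‖b‖`, hence `c a + b ≤ ‖b‖
  -- e`.
  have horth := (S.orth_iff ha hb).1 hab a b ha (by simpa using S.zero_mem 1) hb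
    (by simpa using S.zero_mem 1) c 1
  rw [Complex.ofReal_one, one_smul, max_eq_right hca] at horth
  have hsum := S.matNorm_smul_unit_sub_mem ((isHermitian_ofReal_smul c hah).add hbh)
  rw [horth] at hsum
  have hc1 : (0 : ℝ) < 1 + c := by positivity
  -- Adding `c (t e + a - b) ≥ 0` to `‖b‖ e - (c a + b) ≥ 0` eliminates `a` and leaves `(1 + c) b ≤
  -- (c t + ‖b‖) e`. Taking norms, `c ‖b‖ ≤ c t`.
  have hs : S.matNorm b ≤ (1 + c)⁻¹ * (c * t + S.matNorm b) := by
    refine S.matNorm_le_of_pos_le (by positivity) hb ?_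
    convert S.smul_mem (inv_pos.2 hc1).le (S.add_mem (S.smul_mem hc0.le h) hsum) using 1
    -- The coefficient of `b` is written as `(1 + c)⁻¹ (1 + c)` so that `module` need not cancel the
    -- inverse.
    have hb' : b = ((((1 + c)⁻¹ * (1 + c) : ℝ)) : ℂ) • b := by
      rw [inv_mul_cancel₀ hc1.ne', Complex.ofReal_one, one_smul]
    have he : ((((1 + c)⁻¹ * (c * t + S.matNorm b) : ℝ)) : ℂ) • amp 1 S.unit - b =
        ((((1 + c)⁻¹ * (c * t + S.matNorm b) : ℝ)) : ℂ) • amp 1 S.unit -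
          ((((1 + c)⁻¹ * (1 + c) : ℝ)) : ℂ) • b := by rw [← hb']
    rw [he]
    push_cast
    module
  rw [inv_mul_eq_div, le_div_iff₀ hc1] at hs
  nlinarith

/-- An element of norm one with the absolute matrix order unit property is an order projection. -/
theorem HasAbsMatrixOrderUnitProperty.isOrderProj_amp_one {S : AbsMatrixOrderUnitSpace X} {x : X}
    (hx : S.HasAbsMatrixOrderUnitProperty x) (h1 : S.matNorm (amp 1 x) = 1) :
    S.IsOrderProj (amp 1 x) := by
  have hxh := S.isHermitian_of_pos hx.1
  have heh := S.isHermitian_of_pos S.unit_pos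
  have hex := S.unit_sub_mem hx.1 h1
  rw [amp_sub] at hex
  refine ⟨hxh, ?_⟩
  set E := amp 1 S.unit with hE
  set P := amp 1 x with hP
  have hhalf : (0 : ℝ) ≤ 1 / 2 := by norm_num
  have hhh : ∀ {z : Mat 1 1 X}, z.IsHermitian → (((1 / 2 : ℝ) : ℂ) • z).IsHermitian :=
    fun hz => isHermitian_ofReal_smul _ hz
  set y := P - ((1 / 2 : ℝ) : ℂ) • E with hy
  have hyh : y.IsHermitian := hxh.sub (hhh heh)
  -- The positive and negative parts of `y = x - e/2`; they are orthogonal since `a - b = y` and `a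
  -- + b = |y|`.
  set a := ((1 / 2 : ℝ) : ℂ) • (S.abs y + y) with ha
  set b := ((1 / 2 : ℝ) : ℂ) • (S.abs y - y) with hb
  have hap : a ∈ S.pos 1 := S.smul_mem hhalf (S.abs_add_mem hyh)
  have hbp : b ∈ S.pos 1 := S.smul_mem hhalf (S.abs_sub_mem hyh)
  have hah := S.isHermitian_of_pos hap
  have hbh := S.isHermitian_of_pos hbp
  have hsub : a - b = y := by
    rw [ha, hb]
    push_cast
    module
  have hab : S.abs (a - b) = a + b := by
    rw [hsub, ha, hb]
    push_cast
    module
  -- Here `e/2 + a - b = x ≥ 0`, so `b ≤ e/2 + a`, and orthogonality removes `a`.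
  have hb_le : ((1 / 2 : ℝ) : ℂ) • E - b ∈ S.pos 1 := by
    refine S.le_smul_unit_of_orth hap hbp hab hhalf ?_
    convert hx.1 using 1
    rw [add_sub_assoc, hsub, hy]
    abel
  -- The two expressions `e/2 - b` and `x - a` for `u` play different roles: the first bounds its
  -- norm by `1/2`, the second places it below `x`.
  set u := ((1 / 2 : ℝ) : ℂ) • E - b with hu
  have hua : u = P - a := by
    rw [hu, ← sub_eq_zero]
    have : P = a - b + ((1 / 2 : ℝ) : ℂ) • E := by rw [hsub, hy]; abel
    rw [this]
    abel
  have hPu : P - u ∈ S.pos 1 := by rwa [hua, sub_sub_cancel]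
  have hnorm : S.matNorm u ≤ 1 / 2 := by
    refine S.matNorm_le_of_pos_le (by norm_num) hb_le ?_
    rwa [← hE, hu, sub_sub_cancel]
  -- As `0 ≤ u ≤ x`, the property of `x` applies with `ε = 1`. It turns the norm bound relative to
  -- `e` into an order bound relative to `x`.
  have hprop := hx.2 1 u (S.isHermitian_of_pos hb_le) ⟨1, one_pos, by
    simpa using S.add_mem hx.1 hb_le, by simpa using hPu⟩
  rw [S.abs_of_pos hb_le, amp_smul] at hprop
  have hu_le : ((1 / 2 : ℝ) : ℂ) • P - u ∈ S.pos 1 := by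
    convert S.add_mem hprop (S.smul_mem (sub_nonneg.2 hnorm) hx.1) using 1
    push_cast
    module
  have hPa : a - ((1 / 2 : ℝ) : ℂ) • P ∈ S.pos 1 := by
    convert hu_le using 1
    rw [hua]
    push_cast
    module
  have hEb : b - ((1 / 2 : ℝ) : ℂ) • (E - P) ∈ S.pos 1 := by
    convert hu_le using 1
    rw [hu]
    push_cast
    module
  have hQh := hhh (heh.sub hxh)
  -- Starting from `a ⊥ b`, shrink `b` to `(e - x)/2`, then `a` to `x/2`.
  have o₁ := S.orth_of_le hah hbh hQh hab (S.smul_mem hhalf hex) hEb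
  have o₂ := S.orth_of_le hQh hah (hhh hxh) (S.orth_comm hah hQh o₁) (S.smul_mem hhalf hx.1) hPa
  have o₃ := S.orth_comm hQh (hhh hxh) o₂
  -- Doubling the difference and the sum of `x/2` and `(e - x)/2` gives `2x - e` and `e`.
  have o₄ := S.abs_smul 2 ((hhh hxh).sub hQh)
  rw [o₃] at o₄
  convert o₄ using 2
  · push_cast
    module
  · rw [_root_.abs_of_pos (two_pos : (0 : ℝ) < 2)]
    push_cast
    module

theorem HasAbsMatrixOrderUnitProperty.isOrderProj_amp {S : AbsMatrixOrderUnitSpace X} {x : X}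
    (hx : S.HasAbsMatrixOrderUnitProperty x) (h1 : S.matNorm (amp 1 x) = 1) (n : ℕ+) :
    S.IsOrderProj (amp n x) := by
  induction n with
  | one => exact hx.isOrderProj_amp_one h1
  | succ n ih =>
    rw [amp_add]
    exact ih.dsum S (hx.isOrderProj_amp_one h1)

/-! ### Order projections and condition (T) in `X_x` -/

variable {S}

/-- Order projections of `X_x` are order projections of `X`. -/
theorem IsOrderProj.emb {x : X} {hx : S.HasAbsMatrixOrderUnitProperty x}
    {h1 : S.matNorm (amp 1 x) = 1} {n : ℕ+} {p : Mat n n (S.toMatrixOrderedSpace.sub x hx.1)}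
    (hp : (S.ideal x hx h1).IsOrderProj p) : S.IsOrderProj (AMOU.emb p) := by
  have hph := emb_isHermitian.2 hp.1
  refine ⟨hph, ?_⟩
  have hpp : AMOU.emb p ∈ S.pos n := IsOrderProj.mem (S.ideal x hx h1) hp
  have habs : S.abs ((2 : ℂ) • AMOU.emb p - amp n x) = amp n x := by
    have h := congrArg AMOU.emb hp.2
    rw [emb_amp] at h
    refine Eq.trans ?_ h
    change _ = S.abs (AMOU.emb _)
    rw [emb_sub, emb_smul, emb_amp]
    rfl
  have hxh := S.isHermitian_of_pos (S.amp_mem n hx.1)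
  have heh := S.isHermitian_of_pos (S.amp_mem n S.unit_pos)
  have h2 := isHermitian_ofReal_smul 2 hph
  -- With `z = 2p - xⁿ` and `|z| = xⁿ`, the positive element `|z| - z` equals `2 (xⁿ - p)`.
  have hxp : amp n x - AMOU.emb p ∈ S.pos n := by
    have h := S.abs_sub_mem (h2.sub hxh)
    rw [Complex.ofReal_ofNat, habs] at h
    exact S.half_mem h (by module)
  have hex := S.amp_mem n (S.unit_sub_mem hx.1 h1)
  rw [amp_sub] at hex
  have o₁ : S.abs (AMOU.emb p - (amp n x - AMOU.emb p)) =
      AMOU.emb p + (amp n x - AMOU.emb p) := by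
    convert habs using 2
    · module
    · abel
  -- This is where `xⁿ` being an order projection of `X` enters: `|2xⁿ - eⁿ| = eⁿ` reads `xⁿ ⊥ eⁿ -
  -- xⁿ`.
  have o₂ : S.abs ((amp n S.unit - amp n x) - amp n x) = amp n S.unit - amp n x + amp n x := by
    refine S.orth_comm hxh (heh.sub hxh) ?_
    convert (hx.isOrderProj_amp h1 n).2 using 2
    · module
    · abel
  have o₃ := S.orth_comm (heh.sub hxh) hph
    (S.orth_of_le (heh.sub hxh) hxh hph o₂ hpp hxp)
  -- Orthogonality to both `xⁿ - p` and `eⁿ - xⁿ` passes to the absolute value of their sum, which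
  -- is `eⁿ - p` itself by positivity.
  have o₄ := S.orth_abs_add hph (hxh.sub hph) (heh.sub hxh) o₁ o₃
  rw [S.abs_of_pos (S.add_mem hxp hex)] at o₄
  convert o₄ using 2
  · module
  · abel

/-- A rectangular matrix `w` lies over `X_x` as soon as `|w|` and `|w⋆|` do. -/
theorem HasAbsMatrixOrderUnitProperty.dom_of_abs {x : X} (hx : S.HasAbsMatrixOrderUnitProperty x)
    {l m : ℕ+} {w : Mat l m X} (h : ∀ i j, S.Dom x (S.abs w i j))
    (h' : ∀ i j, S.Dom x (S.abs wᴴ i j)) (i : Idx l) (j : Idx m) : S.Dom x (w i j) := by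
  -- The self-adjoint dilation `z` of `w` has `|z| = |w⋆| ⊕ |w|`. A bound `|z| ≤ ε x` at the matrix
  -- level then bounds `±z`, whose upper right corner is `w`.
  have hz : (blocks 0 w wᴴ 0).IsHermitian := by
    simp [Matrix.IsHermitian, blocks_conjTranspose]
  have hd : ∀ i j, S.Dom x (S.abs (blocks 0 w wᴴ 0) i j) := by
    rw [S.abs_blocks]
    intro i j
    obtain ⟨i, rfl⟩ := (sumEquiv l m).surjective i
    obtain ⟨j, rfl⟩ := (sumEquiv l m).surjective j
    rcases i with i | i <;> rcases j with j | j <;> simp [dsum, S.dom_zero hx.1, h, h']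
  obtain ⟨ε, hε, -, hle⟩ := S.exists_of_dom hx.1 (S.isHermitian_of_pos (S.abs_mem _)) hd
  have key := S.dom_of_le hz hε
    (by convert S.add_mem hle (S.abs_add_mem hz) using 1; abel)
    (by convert S.add_mem hle (S.abs_sub_mem hz) using 1; abel)
    (sumEquiv l m (.inl i)) (sumEquiv l m (.inr j))
  simpa using key

theorem IsPartialIso.emb {x : X} {hx : S.HasAbsMatrixOrderUnitProperty x}
    {h1 : S.matNorm (amp 1 x) = 1} {m n : ℕ+} {v : Mat m n (S.toMatrixOrderedSpace.sub x hx.1)}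
    (hv : (S.ideal x hx h1).IsPartialIso v) : S.IsPartialIso (AMOU.emb v) :=
  ⟨IsOrderProj.emb hv.1, IsOrderProj.emb hv.2⟩

/-- Condition (T) passes to `X_x`. -/
theorem CondT.ideal (hT : S.CondT) {x : X} (hx : S.HasAbsMatrixOrderUnitProperty x)
    (h1 : S.matNorm (amp 1 x) = 1) : (S.ideal x hx h1).CondT := by
  intro l m n u v hu hv huv
  obtain ⟨w, -, h₁, h₂⟩ := hT l m n (emb u) (emb v) hu.emb hv.emb (congrArg emb huv)
  obtain ⟨w, rfl⟩ := exists_emb (hx := hx.1) (hx.dom_of_abs (w := w)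
    (fun i j => by rw [h₂]; exact ((S.ideal x hx h1).abs vᴴ i j).2)
    (fun i j => by rw [h₁]; exact ((S.ideal x hx h1).abs uᴴ i j).2))
  have e₁ : (S.ideal x hx h1).abs wᴴ = (S.ideal x hx h1).abs uᴴ := emb_injective h₁
  have e₂ : (S.ideal x hx h1).abs w = (S.ideal x hx h1).abs vᴴ := emb_injective h₂
  -- That `w` is a partial isometry over `X` would not suffice, since the order unit is now `x`.
  -- Instead `|w| = |v⋆|` and `|w⋆| = |u⋆|` are order projections of `X_x` by assumption on `u` and
  -- `v`.
  exact ⟨w, ⟨e₂ ▸ hv.2, e₁ ▸ hu.2⟩, e₁, e₂⟩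

/-! ### The induced homomorphism on `K₀` -/

section Incl

variable {x : X} {hx : S.HasAbsMatrixOrderUnitProperty x} {h1 : S.matNorm (amp 1 x) = 1}
  (hOP : ∀ (n : ℕ+) (p : Mat n n (S.toMatrixOrderedSpace.sub x hx.1)),
    (S.ideal x hx h1).IsOrderProj p → S.IsOrderProj (emb p))

theorem OPInf.incl_sum (p q : (S.ideal x hx h1).OPInf) :
    (p.sum q).incl hOP = (p.incl hOP).sum (q.incl hOP) := by
  have h := emb_dsum p.mat q.mat
  simp only [OPInf.incl, OPInf.sum, h]

theorem PIEquiv.incl {p q : (S.ideal x hx h1).OPInf} (h : PIEquiv p q) :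
    PIEquiv (p.incl hOP) (q.incl hOP) := by
  obtain ⟨v, h₁, h₂⟩ := h
  exact ⟨emb v, congrArg emb h₁, congrArg emb h₂⟩

/-- The homomorphism of monoids of classes of order projections induced by `X_x ⊆ X`. -/
def OPClass.inclHom (hTx : (S.ideal x hx h1).CondT) (hT : S.CondT) :
    OPClass hTx →+ OPClass hT where
  toFun := Quotient.map (fun p => p.incl hOP) fun _ _ h => PIEquiv.incl hOP h
  map_zero' := rfl
  map_add' := by
    rintro ⟨p⟩ ⟨q⟩
    exact congrArg (OPClass.mk hT) (OPInf.incl_sum hOP p q)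

/-- The homomorphism of `K₀`-groups induced by `X_x ⊆ X`. -/
noncomputable def K0.inclHom (hTx : (S.ideal x hx h1).CondT) (hT : S.CondT) : K0 hTx →+ K0 hT :=
  Algebra.GrothendieckAddGroup.lift
    ((Algebra.GrothendieckAddGroup.of (M := OPClass hT)).comp (OPClass.inclHom hOP hTx hT))

/-- Rewriting a class as a formal difference lets an additive map be evaluated from its values on
the monoid. -/
theorem K0.mk_eq_sub (hT : S.CondT) (p q : S.OPInf) :
    K0.mk hT p q = Algebra.GrothendieckAddGroup.of (OPClass.mk hT p) -
      Algebra.GrothendieckAddGroup.of (OPClass.mk hT q) := by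
  change _ = AddLocalization.addMonoidOf ⊤ _ - AddLocalization.addMonoidOf ⊤ _
  rw [← AddLocalization.mk_zero_eq_addMonoidOf_mk, ← AddLocalization.mk_zero_eq_addMonoidOf_mk,
    Algebra.GrothendieckAddGroup.mk_sub_mk]
  simp [K0.mk]

theorem K0.exists_mk (hT : S.CondT) (z : K0 hT) : ∃ p q, z = K0.mk hT p q := by
  induction z using AddLocalization.ind with
  | H y =>
    obtain ⟨⟨p⟩, ⟨q⟩, hq⟩ := y
    exact ⟨p, q, rfl⟩

theorem K0.inclHom_mk (hTx : (S.ideal x hx h1).CondT) (hT : S.CondT)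
    (p q : (S.ideal x hx h1).OPInf) :
    K0.inclHom hOP hTx hT (K0.mk hTx p q) = K0.mk hT (p.incl hOP) (q.incl hOP) := by
  have h : ∀ a : OPClass hTx, K0.inclHom hOP hTx hT (Algebra.GrothendieckAddGroup.of a) =
      Algebra.GrothendieckAddGroup.of (OPClass.inclHom hOP hTx hT a) :=
    DFunLike.congr_fun (Algebra.GrothendieckAddGroup.lift.symm_apply_apply
      ((Algebra.GrothendieckAddGroup.of (M := OPClass hT)).comp (OPClass.inclHom hOP hTx hT)))
  rw [K0.mk_eq_sub, K0.mk_eq_sub, map_sub, h, h]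
  rfl

/-- Equality of the images of `[(p, q)]` and `[(r, s)]` means `p ⊕ s ≈ r ⊕ q` over `X`. Since the
inclusion commutes with `⊕`, both sides come from projections of `X_x`, and the hypothesis brings
the relation back there. -/
theorem K0.inclHom_injective (hTx : (S.ideal x hx h1).CondT) (hT : S.CondT)
    (h : ∀ p q : (S.ideal x hx h1).OPInf,
      StableEquiv (p.incl hOP) (q.incl hOP) → StableEquiv p q) :
    Function.Injective (K0.inclHom hOP hTx hT) := by
  intro z w hzw
  obtain ⟨p, q, rfl⟩ := K0.exists_mk hTx z
  obtain ⟨r, s, rfl⟩ := K0.exists_mk hTx w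
  rw [K0.inclHom_mk, K0.inclHom_mk, K0.mk_eq_mk_iff, ← OPInf.incl_sum, ← OPInf.incl_sum] at hzw
  exact (K0.mk_eq_mk_iff hTx p q r s).2 (h _ _ hzw)

end Incl

end AbsMatrixOrderUnitSpace

end AMOU

theorem mainTheorem3 {X : Type*} [AddCommGroup X] [Module ℂ X] [StarAddMonoid X] [StarModule ℂ X]
    (S : AMOU.AbsMatrixOrderUnitSpace X) (hT : S.CondT) (x : X)
    (hx : S.HasAbsMatrixOrderUnitProperty x) (h1 : S.matNorm (AMOU.amp 1 x) = 1) :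
    ∃ (hTx : (S.ideal x hx h1).CondT)
      (hOP : ∀ (n : ℕ+) (p : AMOU.Mat n n (S.toMatrixOrderedSpace.sub x hx.1)),
        (S.ideal x hx h1).IsOrderProj p → S.IsOrderProj (AMOU.emb p))
      (f : AMOU.AbsMatrixOrderUnitSpace.K0 hTx →+ AMOU.AbsMatrixOrderUnitSpace.K0 hT),
      (∀ p q : (S.ideal x hx h1).OPInf,
        f (AMOU.AbsMatrixOrderUnitSpace.K0.mk hTx p q) =
          AMOU.AbsMatrixOrderUnitSpace.K0.mk hT (p.incl hOP) (q.incl hOP)) ∧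
      ((∀ p q : (S.ideal x hx h1).OPInf,
          AMOU.AbsMatrixOrderUnitSpace.StableEquiv (p.incl hOP) (q.incl hOP) →
            AMOU.AbsMatrixOrderUnitSpace.StableEquiv p q) →
        Function.Injective f) := by
  exact ⟨hT.ideal hx h1, fun _ _ hp => hp.emb, AMOU.AbsMatrixOrderUnitSpace.K0.inclHom _ _ hT,
    AMOU.AbsMatrixOrderUnitSpace.K0.inclHom_mk _ _ hT,
    AMOU.AbsMatrixOrderUnitSpace.K0.inclHom_injective _ _ hT⟩
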